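/- **Proposition 2.5.** Let $g>0$ and $\mu>0$, and let $\bar\rho\in C^\infty(\mathbb R)$ satisfy $\bar\rho'\in C_0^\infty(\mathbb R)$, $\inf_{\mathbb R}\bar\rho>0$, and $\bar\rho'(x_3^0)>0$ for some $x_3^0\in\mathbb R$. For a frequency $|\xi|>0$ and a parameter $s>0$ put $$\alpha(|\xi|,s)=\inf\Big\{\int_{\mathbb R} s\mu\big(4|\xi|^2|\psi'|^2+\big||\xi|^2\psi+\psi''\big|^2\big)-g|\xi|^2\bar\rho'\psi^2\,dx_3 \;:\; \psi\in H^2(\mathbb R),\ \int_{\mathbb R}\bar\rho\,(|\xi|^2|\psi|^2+|\psi'|^2)\,dx_3=1\Big\},$$ where $\psi$ is real-valued, and let $\mathfrak S_{|\xi|}=\sup\{s : \alpha(|\xi|,\tau)<0 \text{ for all } \tau\in(0,s)\}\in[0,+\infty]$. For every $|\xi|>0$ there is exactly one $s\in(0,\mathfrak S_{|\xi|})$ with $s=\sqrt{-\alpha(|\xi|,s)}$; this $s$ is the growth rate $\lambda(|\xi|)$ of the normal modes of horizontal frequency $\xi$. The function $\lambda:(0,\infty)\to(0,\infty)$ so defined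 is continuous, and $$\sup_{0<|\xi|<\infty}\lambda(|\xi|)\le\sqrt g\,\Big\|\sqrt{\bar\rho'/\bar\rho}\Big\|_{L^\infty(\mathbb R)}<\infty,$$ where $\sqrt{\bar\rho'/\bar\rho}$ is read as $0$ at points where $\bar\rho'<0$. -/

import Mathlib

open MeasureTheory Set
open scoped ContDiff ENNReal

noncomputable section

namespace RayleighTaylor

/-- `v` is the weak derivative of `u` on `ℝ`: `∫ u φ' = -∫ v φ` for every test function
`φ ∈ C_c^∞(ℝ)`. It is used below only for square integrable `u` and `v`, for which both integrals
converge. -/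
def HasWeakDeriv (u v : ℝ → ℝ) : Prop :=
  ∀ φ : ℝ → ℝ, ContDiff ℝ ∞ φ → HasCompactSupport φ →
    ∫ x, u x * deriv φ x = -∫ x, v x * φ x

/-- An element of the real Sobolev space `H²(ℝ)`: a function in `L²(ℝ)` together with its first
and second weak derivatives, which lie in `L²(ℝ)` too. (The weak derivatives are determined by the
function up to null sets.) -/
structure SobolevH2 where
  toFun : ℝ → ℝ
  /-- the weak derivative `ψ'` -/
  d1 : ℝ → ℝ
  /-- the weak second derivative `ψ''` -/
  d2 : ℝ → ℝ
  memLp_toFun : MemLp toFun 2 volume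
  memLp_d1 : MemLp d1 2 volume
  memLp_d2 : MemLp d2 2 volume
  weakDeriv_d1 : HasWeakDeriv toFun d1
  weakDeriv_d2 : HasWeakDeriv d1 d2

/-- The energy `E(ψ) = ∫ sμ (4k²|ψ'|² + |k²ψ + ψ''|²) - g k² ρ' ψ² dx`, where `k = |ξ|`. -/
def energy (ρ : ℝ → ℝ) (g μ k s : ℝ) (ψ : SobolevH2) : ℝ :=
  ∫ x, (s * μ * (4 * k ^ 2 * ψ.d1 x ^ 2 + (k ^ 2 * ψ.toFun x + ψ.d2 x) ^ 2)
    - g * k ^ 2 * deriv ρ x * ψ.toFun x ^ 2)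

/-- The constraint functional `J(ψ) = ∫ ρ (k²|ψ|² + |ψ'|²) dx`, where `k = |ξ|`. -/
def constraint (ρ : ℝ → ℝ) (k : ℝ) (ψ : SobolevH2) : ℝ :=
  ∫ x, ρ x * (k ^ 2 * ψ.toFun x ^ 2 + ψ.d1 x ^ 2)

/-- The admissible set `𝒜 = {ψ ∈ H²(ℝ) : J(ψ) = 1}`. -/
def admissible (ρ : ℝ → ℝ) (k : ℝ) : Set SobolevH2 :=
  {ψ | constraint ρ k ψ = 1}

/-- `α(k, s) = inf {E(ψ) : ψ ∈ 𝒜}`. -/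
def alpha (ρ : ℝ → ℝ) (g μ k s : ℝ) : ℝ :=
  sInf (energy ρ g μ k s '' admissible ρ k)

/-- `𝔖_k = sup {s : α(k, τ) < 0 for every τ ∈ (0, s)}`, possibly `+∞`. -/
def critical (ρ : ℝ → ℝ) (g μ k : ℝ) : EReal :=
  sSup ((fun s : ℝ => (s : EReal)) '' {s | ∀ τ ∈ Ioo (0 : ℝ) s, alpha ρ g μ k τ < 0})

/-- The interval `𝒮_k = (0, 𝔖_k)`. -/
def admissibleParams (ρ : ℝ → ℝ) (g μ k : ℝ) : Set ℝ :=
  {s | 0 < s ∧ (s : EReal) < critical ρ g μ k}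

/-- `λ(k, s) = √(-α(k, s))`, the growth rate of the modified problem with parameter `s ∈ 𝒮_k`. -/
def modifiedRate (ρ : ℝ → ℝ) (g μ k s : ℝ) : ℝ :=
  Real.sqrt (-alpha ρ g μ k s)

/-- `s` is a growth rate of the normal modes of frequency `|ξ| = k`: it lies in `𝒮_k` and is a
fixed point of the growth rate of the modified problem, `s = λ(k, s)`. -/
def IsGrowthRate (ρ : ℝ → ℝ) (g μ k s : ℝ) : Prop :=
  s ∈ admissibleParams ρ g μ k ∧ s = modifiedRate ρ g μ k s

end RayleighTaylor

end

/-! ### Bounds on the density, and elements of `H²`. -/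

namespace RayleighTaylor

/-! For fixed `k`, `α(k, ·)` is an infimum of affine functions of `s` with slopes `μ · dissipation ≥
0`, so it is concave (hence continuous) and nondecreasing on `s > 0`. Therefore `s² + α(k, s)` is
continuous and strictly increasing. It is nonpositive at some small `s`, since `ρ'` is positive
somewhere, and nonnegative for large `s`, since `α ≥ -gc` whenever `ρ' ≤ cρ`; its zero is the growth
rate. No minimizer is needed.

By homogeneity (`le_alpha_iff`), `λ(k) ≤ s` means that the quadratic form `E + s²J` is nonnegative
on `H²` (`le_iff_neg_sq_le_alpha`). Raising `s` makes this form coercive enough to absorb a small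
change of `k` (`exists_perturbation_radius`), which gives continuity. The bound on `λ` is `α ≥ -gc`
with the sharp `c`. -/

/-- Bounds for a density profile `ρ`: `m ≤ ρ ≤ L` with `m > 0`, and `|ρ'| ≤ N`. -/
structure DensityBounds (ρ : ℝ → ℝ) (m L N : ℝ) : Prop where
  continuous : Continuous ρ
  continuous_deriv : Continuous (deriv ρ)
  pos : 0 < m
  le : ∀ x, m ≤ ρ x
  ge : ∀ x, ρ x ≤ L
  abs_deriv_le : ∀ x, |deriv ρ x| ≤ N

theorem exists_densityBounds {ρ : ℝ → ℝ} (hsm : ContDiff ℝ ∞ ρ)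
    (hsupp : HasCompactSupport (deriv ρ)) (hpos : 0 < ⨅ x, ρ x) :
    ∃ m L N : ℝ, DensityBounds ρ m L N := by
  have hc : Continuous (deriv ρ) := hsm.continuous_deriv (by simp)
  obtain ⟨N, hN⟩ := hsupp.exists_bound_of_continuous hc
  have hint : Integrable (deriv ρ) := hc.integrable_of_hasCompactSupport hsupp
  -- A range unbounded below would have real infimum `0` by convention, against `hpos`.
  have hbdd : BddBelow (range ρ) := by
    by_contra h
    exact absurd hpos (by rw [iInf, Real.sInf_of_not_bddBelow h]; simp)
  refine ⟨⨅ x, ρ x, ρ 0 + ∫ x, ‖deriv ρ x‖, N, hsm.continuous, hc, hpos,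
    fun x => ciInf_le hbdd x, fun x => ?_, fun x => hN x⟩
  have h1 : ∫ y in (0 : ℝ)..x, deriv ρ y = ρ x - ρ 0 :=
    intervalIntegral.integral_deriv_eq_sub
      (fun y _ => (hsm.differentiable (by simp)).differentiableAt)
      (hc.intervalIntegrable _ _)
  have h2 : ‖∫ y in (0 : ℝ)..x, deriv ρ y‖ ≤ ∫ y, ‖deriv ρ y‖ :=
    (intervalIntegral.norm_integral_le_integral_norm_uIoc).trans
      (setIntegral_le_integral hint.norm (Filter.Eventually.of_forall fun _ => norm_nonneg _))
  rw [h1] at h2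
  linarith [le_abs_self (ρ x - ρ 0), Real.norm_eq_abs (ρ x - ρ 0)]

namespace SobolevH2

/-- Scalar multiple of an element of `H²(ℝ)`. -/
def smul (c : ℝ) (ψ : SobolevH2) : SobolevH2 where
  toFun x := c * ψ.toFun x
  d1 x := c * ψ.d1 x
  d2 x := c * ψ.d2 x
  memLp_toFun := ψ.memLp_toFun.const_mul c
  memLp_d1 := ψ.memLp_d1.const_mul c
  memLp_d2 := ψ.memLp_d2.const_mul c
  weakDeriv_d1 φ h h' := by
    simp only [mul_assoc, integral_const_mul, ψ.weakDeriv_d1 φ h h', mul_neg]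
  weakDeriv_d2 φ h h' := by
    simp only [mul_assoc, integral_const_mul, ψ.weakDeriv_d2 φ h h', mul_neg]

end SobolevH2

theorem hasWeakDeriv_of_contDiff {f : ℝ → ℝ} (hf : ContDiff ℝ 1 f) :
    HasWeakDeriv f (deriv f) := by
  intro φ hφ hφs
  have hφ1 : Continuous (deriv φ) := hφ.continuous_deriv (by simp)
  have hf1 : Continuous (deriv f) := hf.continuous_deriv le_rfl
  refine integral_mul_deriv_eq_deriv_mul_of_integrable
    (fun x _ => (hf.differentiable one_ne_zero x).hasDerivAt)
    (fun x _ => (hφ.differentiable (by simp) x).hasDerivAt) ?_ ?_ ?_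
  · exact (hf.continuous.mul hφ1).integrable_of_hasCompactSupport hφs.deriv.mul_left
  · exact (hf1.mul hφ.continuous).integrable_of_hasCompactSupport hφs.mul_left
  · exact (hf.continuous.mul hφ.continuous).integrable_of_hasCompactSupport hφs.mul_left

/-- A test function as an element of `H²(ℝ)`. -/
noncomputable def SobolevH2.ofContDiff (f : ℝ → ℝ) (hf : ContDiff ℝ 2 f) (hs : HasCompactSupport f) :
    SobolevH2 where
  toFun := f
  d1 := deriv f
  d2 := deriv (deriv f)
  memLp_toFun := hf.continuous.memLp_of_hasCompactSupport hs
  memLp_d1 := (hf.continuous_deriv (by norm_num)).memLp_of_hasCompactSupport hs.deriv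
  memLp_d2 := ((contDiff_succ_iff_deriv (n := 1).1 hf).2.2.continuous_deriv
    le_rfl).memLp_of_hasCompactSupport hs.deriv.deriv
  weakDeriv_d1 := hasWeakDeriv_of_contDiff (hf.of_le (by norm_num))
  weakDeriv_d2 := hasWeakDeriv_of_contDiff (contDiff_succ_iff_deriv (n := 1).1 hf).2.2

/-! ### Energy and constraint in terms of integral moments. -/

section Moments

variable {ρ : ℝ → ℝ} {m L N : ℝ}

/-- The integral `∫ w f²`. -/
noncomputable def weightedSq (w f : ℝ → ℝ) : ℝ := ∫ x, w x * f x ^ 2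

theorem integrable_mul_sq {w f : ℝ → ℝ} {K : ℝ} (hw : Continuous w) (hK : ∀ x, |w x| ≤ K)
    (hf : MemLp f 2 volume) : Integrable fun x => w x * f x ^ 2 :=
  hf.integrable_sq.bdd_mul hw.aestronglyMeasurable (Filter.Eventually.of_forall hK)

theorem DensityBounds.abs_le (h : DensityBounds ρ m L N) (x : ℝ) : |ρ x| ≤ L := by
  rw [abs_of_nonneg (h.pos.le.trans (h.le x))]
  exact h.ge x

theorem DensityBounds.integrable_mul_sq (h : DensityBounds ρ m L N) {f : ℝ → ℝ}
    (hf : MemLp f 2 volume) : Integrable fun x => ρ x * f x ^ 2 :=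
  RayleighTaylor.integrable_mul_sq h.continuous h.abs_le hf

theorem DensityBounds.integrable_deriv_mul_sq (h : DensityBounds ρ m L N) {f : ℝ → ℝ}
    (hf : MemLp f 2 volume) : Integrable fun x => deriv ρ x * f x ^ 2 :=
  RayleighTaylor.integrable_mul_sq h.continuous_deriv h.abs_deriv_le hf

theorem DensityBounds.mul_le_weightedSq (h : DensityBounds ρ m L N) {f : ℝ → ℝ}
    (hf : MemLp f 2 volume) : m * ∫ x, f x ^ 2 ≤ weightedSq ρ f := by
  rw [weightedSq, ← integral_const_mul]
  exact integral_mono (hf.integrable_sq.const_mul m) (h.integrable_mul_sq hf)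
    fun x => mul_le_mul_of_nonneg_right (h.le x) (sq_nonneg _)

theorem DensityBounds.weightedSq_le (h : DensityBounds ρ m L N) {f : ℝ → ℝ}
    (hf : MemLp f 2 volume) : weightedSq ρ f ≤ L * ∫ x, f x ^ 2 := by
  rw [weightedSq, ← integral_const_mul]
  exact integral_mono (h.integrable_mul_sq hf) (hf.integrable_sq.const_mul L)
    fun x => mul_le_mul_of_nonneg_right (h.ge x) (sq_nonneg _)

theorem DensityBounds.abs_weightedSq_deriv_le (h : DensityBounds ρ m L N) {f : ℝ → ℝ}
    (hf : MemLp f 2 volume) : |weightedSq (deriv ρ) f| ≤ N * ∫ x, f x ^ 2 := by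
  rw [weightedSq, ← integral_const_mul]
  refine (abs_integral_le_integral_abs).trans
    (integral_mono (h.integrable_deriv_mul_sq hf).abs (hf.integrable_sq.const_mul N) fun x => ?_)
  simp only [abs_mul, abs_sq]
  exact mul_le_mul_of_nonneg_right (h.abs_deriv_le x) (sq_nonneg _)

theorem DensityBounds.weightedSq_deriv_le_mul (h : DensityBounds ρ m L N) {f : ℝ → ℝ} {c : ℝ}
    (hc : ∀ᵐ x, deriv ρ x ≤ c * ρ x) (hf : MemLp f 2 volume) :
    weightedSq (deriv ρ) f ≤ c * weightedSq ρ f := by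
  rw [weightedSq, weightedSq, ← integral_const_mul]
  refine integral_mono_ae (h.integrable_deriv_mul_sq hf) ((h.integrable_mul_sq hf).const_mul c) ?_
  filter_upwards [hc] with x hx
  rw [← mul_assoc]
  exact mul_le_mul_of_nonneg_right hx (sq_nonneg _)

variable (ψ : SobolevH2)

/-- The dissipation `∫ 4t|ψ'|² + |tψ + ψ''|²`, where `t = |ξ|²`. -/
noncomputable def dissipation (t : ℝ) : ℝ :=
  4 * t * (∫ x, ψ.d1 x ^ 2) + ∫ x, (t * ψ.toFun x + ψ.d2 x) ^ 2

/-- Makes the dependence on `t` polynomial, with moments of `ψ` as coefficients; nonnegativity for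
every real `t` later controls the cross term. -/
theorem integral_add_sq (t : ℝ) :
    ∫ x, (t * ψ.toFun x + ψ.d2 x) ^ 2 =
      t ^ 2 * (∫ x, ψ.toFun x ^ 2) + 2 * t * (∫ x, ψ.toFun x * ψ.d2 x) + ∫ x, ψ.d2 x ^ 2 := by
  have hB := ψ.memLp_toFun.integrable_sq
  have hF := ψ.memLp_d2.integrable_sq
  have hC : Integrable fun x => ψ.toFun x * ψ.d2 x :=
    ψ.memLp_toFun.integrable_mul ψ.memLp_d2
  have hBC : Integrable fun x => t ^ 2 * ψ.toFun x ^ 2 + 2 * t * (ψ.toFun x * ψ.d2 x) :=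
    (hB.const_mul _).add (hC.const_mul _)
  rw [← integral_const_mul, ← integral_const_mul,
    ← integral_add (hB.const_mul _) (hC.const_mul _),
    ← integral_add hBC hF]
  congr 1 with x
  ring

theorem dissipation_nonneg {t : ℝ} (ht : 0 ≤ t) : 0 ≤ dissipation ψ t :=
  add_nonneg (mul_nonneg (by linarith) (integral_nonneg fun _ => sq_nonneg _))
    (integral_nonneg fun _ => sq_nonneg _)

theorem DensityBounds.energy_eq (h : DensityBounds ρ m L N) (g μ k s : ℝ) :
    energy ρ g μ k s ψ =
      s * μ * dissipation ψ (k ^ 2) - g * k ^ 2 * weightedSq (deriv ρ) ψ.toFun := by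
  have hA := ψ.memLp_d1.integrable_sq
  have hD := ((ψ.memLp_toFun.const_mul (k ^ 2)).add ψ.memLp_d2).integrable_sq
  have hP := h.integrable_deriv_mul_sq ψ.memLp_toFun
  simp only [Pi.add_apply] at hD
  have hAD : Integrable fun x =>
      4 * k ^ 2 * ψ.d1 x ^ 2 + (k ^ 2 * ψ.toFun x + ψ.d2 x) ^ 2 := (hA.const_mul _).add hD
  rw [energy, dissipation, weightedSq, ← integral_const_mul, ← integral_const_mul,
    ← integral_add (hA.const_mul _) hD, ← integral_const_mul,
    ← integral_sub (hAD.const_mul _) (hP.const_mul _)]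
  congr 1 with x
  ring

theorem DensityBounds.constraint_eq (h : DensityBounds ρ m L N) (k : ℝ) :
    constraint ρ k ψ = k ^ 2 * weightedSq ρ ψ.toFun + weightedSq ρ ψ.d1 := by
  have hR := h.integrable_mul_sq ψ.memLp_toFun
  have hS := h.integrable_mul_sq ψ.memLp_d1
  rw [constraint, weightedSq, weightedSq, ← integral_const_mul,
    ← integral_add (hR.const_mul _) hS]
  congr 1 with x
  ring

theorem DensityBounds.weightedSq_nonneg (h : DensityBounds ρ m L N) (f : ℝ → ℝ) :
    0 ≤ weightedSq ρ f :=
  integral_nonneg fun x => mul_nonneg (h.pos.le.trans (h.le x)) (sq_nonneg _)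

theorem DensityBounds.constraint_nonneg (h : DensityBounds ρ m L N) (k : ℝ) :
    0 ≤ constraint ρ k ψ := by
  rw [h.constraint_eq]
  exact add_nonneg (mul_nonneg (sq_nonneg _) (h.weightedSq_nonneg _)) (h.weightedSq_nonneg _)

theorem energy_smul (ρ : ℝ → ℝ) (g μ k s c : ℝ) :
    energy ρ g μ k s (ψ.smul c) = c ^ 2 * energy ρ g μ k s ψ := by
  rw [energy, energy, ← integral_const_mul]
  congr 1 with x
  simp only [SobolevH2.smul]
  ring

theorem constraint_smul (ρ : ℝ → ℝ) (k c : ℝ) :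
    constraint ρ k (ψ.smul c) = c ^ 2 * constraint ρ k ψ := by
  rw [constraint, constraint, ← integral_const_mul]
  congr 1 with x
  simp only [SobolevH2.smul]
  ring

/-- If `ρ' ≤ cρ` then the energy is at least `-gc` times the constraint functional. -/
theorem DensityBounds.neg_mul_constraint_le_energy (h : DensityBounds ρ m L N) {c g μ k s : ℝ}
    (hc0 : 0 ≤ c) (hc : ∀ᵐ x, deriv ρ x ≤ c * ρ x) (hg : 0 < g) (hμ : 0 < μ) (hs : 0 ≤ s) :
    -(g * c) * constraint ρ k ψ ≤ energy ρ g μ k s ψ := by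
  rw [h.energy_eq, h.constraint_eq]
  have h1 := mul_nonneg (mul_nonneg hs hμ.le) (dissipation_nonneg ψ (sq_nonneg k))
  have h2 := mul_le_mul_of_nonneg_left (h.weightedSq_deriv_le_mul hc ψ.memLp_toFun)
    (mul_nonneg hg.le (sq_nonneg k))
  have h3 := mul_nonneg (mul_nonneg hg.le hc0) (h.weightedSq_nonneg ψ.d1)
  linarith

/-- The crude constant `c = N / m`: enough for finiteness of the infimum and existence of the fixed
point. -/
theorem DensityBounds.deriv_le (h : DensityBounds ρ m L N) (x : ℝ) :
    deriv ρ x ≤ N / m * ρ x := by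
  have hN : 0 ≤ N := (abs_nonneg _).trans (h.abs_deriv_le x)
  calc deriv ρ x ≤ N := (le_abs_self _).trans (h.abs_deriv_le x)
    _ = N / m * m := (div_mul_cancel₀ N h.pos.ne').symm
    _ ≤ N / m * ρ x := mul_le_mul_of_nonneg_left (h.le x) (div_nonneg hN h.pos.le)

theorem DensityBounds.ratio_nonneg (h : DensityBounds ρ m L N) : 0 ≤ N / m :=
  div_nonneg ((abs_nonneg _).trans (h.abs_deriv_le 0)) h.pos.le

end Moments

/-- If `ρ'` is positive somewhere then some `ψ ∈ H²(ℝ)` has `∫ ρ'ψ² > 0`. -/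
theorem exists_weightedSq_deriv_pos {ρ : ℝ → ℝ} (hc : Continuous (deriv ρ))
    (hRT : ∃ x₀ : ℝ, 0 < deriv ρ x₀) : ∃ ψ : SobolevH2, 0 < weightedSq (deriv ρ) ψ.toFun := by
  obtain ⟨x₀, hx₀⟩ := hRT
  obtain ⟨δ, hδ, hball⟩ := Metric.isOpen_iff.1 (isOpen_lt continuous_const hc) x₀ hx₀
  let b : ContDiffBump x₀ := ⟨δ / 2, δ, half_pos hδ, half_lt_self hδ⟩
  refine ⟨.ofContDiff b b.contDiff b.hasCompactSupport, ?_⟩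
  refine Continuous.integral_pos_of_hasCompactSupport_nonneg_nonzero (x := x₀)
    (hc.mul (b.continuous.pow 2)) ?_ ?_ ?_
  · have : HasCompactSupport fun x => b x * b x := b.hasCompactSupport.mul_left
    simp only [SobolevH2.ofContDiff, pow_two]
    exact this.mul_left
  · intro x
    by_cases hx : x ∈ Metric.ball x₀ δ
    · exact mul_nonneg (le_of_lt (hball hx)) (sq_nonneg _)
    · have : b x = 0 := b.zero_of_le_dist (not_lt.1 hx)
      simp [SobolevH2.ofContDiff, this]
  · have : b x₀ = 1 := b.one_of_mem_closedBall (by simp [b, (half_pos hδ).le])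
    simp [SobolevH2.ofContDiff, this, hx₀.ne']

/-! ### The infimum `α` as a function of `s`, and its fixed point. -/

section Alpha

variable {ρ : ℝ → ℝ} {m L N g μ k s : ℝ}

theorem DensityBounds.exists_constraint_pos_energy_neg (h : DensityBounds ρ m L N)
    (hRT : ∃ x₀ : ℝ, 0 < deriv ρ x₀) (hg : 0 < g) (hμ : 0 < μ) (hk : 0 < k) :
    ∃ ψ : SobolevH2, 0 < constraint ρ k ψ ∧ ∃ s, 0 < s ∧ energy ρ g μ k s ψ < 0 := by
  obtain ⟨ψ, hψ⟩ := exists_weightedSq_deriv_pos h.continuous_deriv hRT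
  have hD := dissipation_nonneg ψ (sq_nonneg k)
  have hP : 0 < g * k ^ 2 * weightedSq (deriv ρ) ψ.toFun := by positivity
  -- With `P = gk²∫ρ'ψ²` and dissipation `D`, this `s` gives `sμD = P·D/(D+1) < P`; the `+ 1` avoids
  -- dividing by zero.
  refine ⟨ψ, ?_, g * k ^ 2 * weightedSq (deriv ρ) ψ.toFun / (μ * (dissipation ψ (k ^ 2) + 1)),
    by positivity, ?_⟩
  · have h1 := h.weightedSq_deriv_le_mul (Filter.Eventually.of_forall h.deriv_le)
      ψ.memLp_toFun
    have h2 : 0 < weightedSq ρ ψ.toFun := pos_of_mul_pos_right (hψ.trans_le h1) h.ratio_nonneg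
    have h3 := h.weightedSq_nonneg ψ.d1
    rw [h.constraint_eq]
    positivity
  · rw [h.energy_eq, sub_neg]
    have : g * k ^ 2 * weightedSq (deriv ρ) ψ.toFun / (μ * (dissipation ψ (k ^ 2) + 1)) * μ *
        dissipation ψ (k ^ 2) = g * k ^ 2 * weightedSq (deriv ρ) ψ.toFun *
          (dissipation ψ (k ^ 2) / (dissipation ψ (k ^ 2) + 1)) := by
      field_simp
    rw [this]
    exact mul_lt_of_lt_one_right hP ((div_lt_one (by linarith)).2 (by linarith))

theorem admissible_smul_mem {ψ : SobolevH2} (hψ : 0 < constraint ρ k ψ) :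
    ψ.smul (Real.sqrt (constraint ρ k ψ))⁻¹ ∈ admissible ρ k := by
  rw [admissible, mem_ofPred_eq, constraint_smul, inv_pow, Real.sq_sqrt hψ.le,
    inv_mul_cancel₀ hψ.ne']

theorem DensityBounds.admissible_nonempty (h : DensityBounds ρ m L N)
    (hRT : ∃ x₀ : ℝ, 0 < deriv ρ x₀) (hk : 0 < k) : (admissible ρ k).Nonempty := by
  obtain ⟨ψ, hψ, -⟩ := h.exists_constraint_pos_energy_neg hRT one_pos one_pos hk
  exact ⟨_, admissible_smul_mem hψ⟩

theorem DensityBounds.bddBelow_energy (h : DensityBounds ρ m L N) (hg : 0 < g) (hμ : 0 < μ)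
    (hs : 0 ≤ s) : BddBelow (energy ρ g μ k s '' admissible ρ k) := by
  refine ⟨-(g * (N / m)), ?_⟩
  rintro _ ⟨ψ, hψ, rfl⟩
  have := h.neg_mul_constraint_le_energy ψ (k := k) h.ratio_nonneg
    (Filter.Eventually.of_forall h.deriv_le) hg hμ hs
  rwa [show constraint ρ k ψ = 1 from hψ, mul_one] at this

/-- `α(k, s)` is the largest `c` with `cJ ≤ E` on all of `H²(ℝ)`. -/
theorem DensityBounds.le_alpha_iff (h : DensityBounds ρ m L N)
    (hRT : ∃ x₀ : ℝ, 0 < deriv ρ x₀) (hg : 0 < g) (hμ : 0 < μ) (hk : 0 < k) (hs : 0 ≤ s)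
    {c : ℝ} : c ≤ alpha ρ g μ k s ↔ ∀ ψ, c * constraint ρ k ψ ≤ energy ρ g μ k s ψ := by
  constructor
  · intro hc ψ
    -- If `J(ψ) = 0`, the lower bound by a multiple of `J` already gives `E(ψ) ≥ 0`; otherwise
    -- normalize `ψ`.
    rcases (h.constraint_nonneg ψ k).eq_or_lt with h0 | h0
    · have := h.neg_mul_constraint_le_energy ψ (k := k) h.ratio_nonneg
        (Filter.Eventually.of_forall h.deriv_le) hg hμ hs
      rw [← h0, mul_zero] at this ⊢
      exact this
    · have := hc.trans (csInf_le (h.bddBelow_energy hg hμ hs)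
        (mem_image_of_mem _ (admissible_smul_mem h0)))
      rw [energy_smul, inv_pow, Real.sq_sqrt h0.le, inv_mul_eq_div, le_div_iff₀ h0] at this
      exact this
  · intro hc
    refine le_csInf ((h.admissible_nonempty hRT hk).image _) ?_
    rintro _ ⟨ψ, hψ, rfl⟩
    simpa [show constraint ρ k ψ = 1 from hψ] using hc ψ

theorem DensityBounds.alpha_le_energy (h : DensityBounds ρ m L N) (hg : 0 < g) (hμ : 0 < μ)
    (hs : 0 ≤ s) {ψ : SobolevH2} (hψ : ψ ∈ admissible ρ k) :
    alpha ρ g μ k s ≤ energy ρ g μ k s ψ :=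
  csInf_le (h.bddBelow_energy hg hμ hs) (mem_image_of_mem _ hψ)

theorem DensityBounds.alpha_mono (h : DensityBounds ρ m L N) (hRT : ∃ x₀ : ℝ, 0 < deriv ρ x₀)
    (hg : 0 < g) (hμ : 0 < μ) (hk : 0 < k) {s₁ s₂ : ℝ} (h₁ : 0 ≤ s₁) (h₁₂ : s₁ ≤ s₂) :
    alpha ρ g μ k s₁ ≤ alpha ρ g μ k s₂ := by
  refine le_csInf ((h.admissible_nonempty hRT hk).image _) ?_
  rintro _ ⟨ψ, hψ, rfl⟩
  refine (h.alpha_le_energy hg hμ h₁ hψ).trans ?_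
  rw [h.energy_eq, h.energy_eq]
  have := dissipation_nonneg ψ (sq_nonneg k)
  gcongr

theorem DensityBounds.concaveOn_alpha (h : DensityBounds ρ m L N)
    (hRT : ∃ x₀ : ℝ, 0 < deriv ρ x₀) (hg : 0 < g) (hμ : 0 < μ) (hk : 0 < k) :
    ConcaveOn ℝ (Ioi 0) (alpha ρ g μ k) := by
  refine ⟨convex_Ioi 0, fun x hx y hy a b ha hb hab => ?_⟩
  refine le_csInf ((h.admissible_nonempty hRT hk).image _) ?_
  rintro _ ⟨ψ, hψ, rfl⟩
  have h1 := mul_le_mul_of_nonneg_left (h.alpha_le_energy hg hμ (le_of_lt hx) hψ) ha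
  have h2 := mul_le_mul_of_nonneg_left (h.alpha_le_energy hg hμ (le_of_lt hy) hψ) hb
  refine (add_le_add h1 h2).trans_eq ?_
  simp only [h.energy_eq, smul_eq_mul]
  linear_combination (-(g * k ^ 2 * weightedSq (deriv ρ) ψ.toFun)) * hab

theorem DensityBounds.continuousOn_alpha (h : DensityBounds ρ m L N)
    (hRT : ∃ x₀ : ℝ, 0 < deriv ρ x₀) (hg : 0 < g) (hμ : 0 < μ) (hk : 0 < k) :
    ContinuousOn (alpha ρ g μ k) (Ioi 0) :=
  (h.concaveOn_alpha hRT hg hμ hk).continuousOn isOpen_Ioi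

theorem DensityBounds.exists_alpha_neg (h : DensityBounds ρ m L N)
    (hRT : ∃ x₀ : ℝ, 0 < deriv ρ x₀) (hg : 0 < g) (hμ : 0 < μ) (hk : 0 < k) :
    ∃ s, 0 < s ∧ alpha ρ g μ k s < 0 := by
  obtain ⟨ψ, hψ, s, hs, hE⟩ := h.exists_constraint_pos_energy_neg hRT hg hμ hk
  refine ⟨s, hs, ?_⟩
  by_contra! h0
  have := (h.le_alpha_iff hRT hg hμ hk hs.le).1 h0 ψ
  linarith

/-- If `ρ' ≤ cρ` then `α ≥ -gc`. -/
theorem DensityBounds.neg_mul_le_alpha (h : DensityBounds ρ m L N)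
    (hRT : ∃ x₀ : ℝ, 0 < deriv ρ x₀) (hg : 0 < g) (hμ : 0 < μ) (hk : 0 < k) (hs : 0 ≤ s) {c : ℝ}
    (hc0 : 0 ≤ c) (hc : ∀ᵐ x, deriv ρ x ≤ c * ρ x) : -(g * c) ≤ alpha ρ g μ k s :=
  (h.le_alpha_iff hRT hg hμ hk hs).2 fun ψ => h.neg_mul_constraint_le_energy ψ hc0 hc hg hμ hs

theorem DensityBounds.exists_sq_eq_neg_alpha (h : DensityBounds ρ m L N)
    (hRT : ∃ x₀ : ℝ, 0 < deriv ρ x₀) (hg : 0 < g) (hμ : 0 < μ) (hk : 0 < k) :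
    ∃ s, 0 < s ∧ s ^ 2 = -alpha ρ g μ k s := by
  obtain ⟨s₁, hs₁, h₁⟩ := h.exists_alpha_neg hRT hg hμ hk
  have hc0 := h.ratio_nonneg
  set c := N / m with hc
  -- Monotonicity gives `α(a) ≤ α(s₁)`, while `a² ≤ -α(s₁)`.
  set a := min s₁ (Real.sqrt (-alpha ρ g μ k s₁)) with ha
  have ha0 : 0 < a := lt_min hs₁ (Real.sqrt_pos.2 (by linarith))
  have hFa : a ^ 2 + alpha ρ g μ k a ≤ 0 := by
    have h1 := h.alpha_mono hRT hg hμ hk ha0.le (min_le_left _ _)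
    have h2 := pow_le_pow_left₀ ha0.le (min_le_right s₁ (Real.sqrt (-alpha ρ g μ k s₁))) 2
    rw [Real.sq_sqrt (by linarith)] at h2
    linarith
  -- Here `b² ≥ gc ≥ -α(b)`; adding `a` ensures `a ≤ b`.
  set b := a + Real.sqrt (g * c) with hb
  have hab : a ≤ b := le_add_of_nonneg_right (Real.sqrt_nonneg _)
  have hFb : 0 ≤ b ^ 2 + alpha ρ g μ k b := by
    have h1 := h.neg_mul_le_alpha hRT hg hμ hk (ha0.le.trans hab) hc0
      (Filter.Eventually.of_forall h.deriv_le)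
    have h2 := pow_le_pow_left₀ (Real.sqrt_nonneg (g * c))
      (le_add_of_nonneg_left ha0.le : Real.sqrt (g * c) ≤ b) 2
    rw [Real.sq_sqrt (by positivity)] at h2
    linarith
  have hcont : ContinuousOn (fun s => s ^ 2 + alpha ρ g μ k s) (Icc a b) :=
    ((continuous_pow 2).continuousOn).add
      ((h.continuousOn_alpha hRT hg hμ hk).mono fun x hx => ha0.trans_le hx.1)
  obtain ⟨s, hs, hs0⟩ := intermediate_value_Icc hab hcont ⟨hFa, hFb⟩
  exact ⟨s, ha0.trans_le hs.1, by simp only at hs0; linarith⟩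

/-- Holds because `s² + α(k, s)` is strictly increasing and vanishes at `r`. It yields uniqueness,
and reduces comparisons of growth rates to inequalities between forms. -/
theorem DensityBounds.le_iff_neg_sq_le_alpha (h : DensityBounds ρ m L N)
    (hRT : ∃ x₀ : ℝ, 0 < deriv ρ x₀) (hg : 0 < g) (hμ : 0 < μ) (hk : 0 < k) {r : ℝ}
    (hr : 0 < r) (hr' : r ^ 2 = -alpha ρ g μ k r) (hs : 0 ≤ s) :
    r ≤ s ↔ -s ^ 2 ≤ alpha ρ g μ k s := by
  constructor
  · intro hle
    have := h.alpha_mono hRT hg hμ hk hr.le hle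
    nlinarith
  · intro h1
    by_contra! hlt
    have := h.alpha_mono hRT hg hμ hk hs hlt.le
    nlinarith

/-- Membership in `(0, 𝔖_k)` is automatic: a positive fixed point has `α < 0`, continuity extends
this slightly beyond `s`, and monotonicity to everything below. -/
theorem DensityBounds.isGrowthRate_iff (h : DensityBounds ρ m L N)
    (hRT : ∃ x₀ : ℝ, 0 < deriv ρ x₀) (hg : 0 < g) (hμ : 0 < μ) (hk : 0 < k) :
    IsGrowthRate ρ g μ k s ↔ 0 < s ∧ s ^ 2 = -alpha ρ g μ k s := by
  constructor
  · rintro ⟨⟨hs, -⟩, hfix⟩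
    refine ⟨hs, ?_⟩
    rw [modifiedRate] at hfix
    have := Real.sqrt_pos.1 (hfix ▸ hs)
    conv_lhs => rw [hfix]
    exact Real.sq_sqrt this.le
  · rintro ⟨hs, hsq⟩
    refine ⟨⟨hs, ?_⟩, by rw [modifiedRate, ← hsq, Real.sqrt_sq hs.le]⟩
    have hneg : alpha ρ g μ k s < 0 := by nlinarith
    have hev : ∀ᶠ τ in nhds s, alpha ρ g μ k τ < 0 :=
      ((h.continuousOn_alpha hRT hg hμ hk).continuousAt (Ioi_mem_nhds hs)).eventually_lt_const hneg
    obtain ⟨ε, hε, hball⟩ := Metric.eventually_nhds_iff.1 hev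
    have hlt : s < s + ε / 2 := by linarith
    refine (EReal.coe_lt_coe_iff.2 hlt).trans_le (le_sSup (mem_image_of_mem _ ?_))
    intro τ hτ
    exact (h.alpha_mono hRT hg hμ hk hτ.1.le hτ.2.le).trans_lt
      (hball (by rw [Real.dist_eq, add_sub_cancel_left, abs_of_pos (half_pos hε)]; linarith))

end Alpha

/-! ### Continuity in the frequency. -/

/-- Algebraic core of the continuous dependence on `t = |ξ|²`: an increase of `s` gains a definite
multiple of the squared `H²` norm, which absorbs a small change of `t`. -/
theorem exists_perturbation_radius {m L N g μ t₀ s₁ s₂ : ℝ} (hm : 0 < m) (hL : 0 ≤ L)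
    (hN : 0 ≤ N) (hg : 0 < g) (hμ : 0 < μ) (ht₀ : 0 < t₀) (hs₁ : 0 < s₁) (hs : s₁ < s₂) :
    ∃ δ > 0, ∀ t t' : ℝ, |t - t₀| < δ → |t' - t₀| < δ → ∀ A B C F P R S : ℝ,
      0 ≤ A → 0 ≤ B → 0 ≤ F → (∀ x : ℝ, 0 ≤ x ^ 2 * B + 2 * x * C + F) → |P| ≤ N * B →
      m * B ≤ R → R ≤ L * B → m * A ≤ S →
      0 ≤ s₁ * μ * (4 * t * A + (t ^ 2 * B + 2 * t * C + F)) - g * t * P + s₁ ^ 2 * (t * R + S) →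
      0 ≤ s₂ * μ * (4 * t' * A + (t' ^ 2 * B + 2 * t' * C + F)) - g * t' * P
        + s₂ ^ 2 * (t' * R + S) := by
  have hs₂ : 0 < s₂ := hs₁.trans hs
  obtain ⟨d, hd0, hd⟩ : ∃ d, 0 < d ∧ s₂ ^ 2 = s₁ ^ 2 + d :=
    ⟨s₂ ^ 2 - s₁ ^ 2, by nlinarith, by ring⟩
  -- The part of the dissipation gain that is spent: the second bound lets half of the gain `d * m *
  -- t * B` absorb the loss `η * t ^ 2 * B`.
  set η := min ((s₂ - s₁) * μ) (d * m / (4 * t₀)) with hη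
  have hη0 : 0 < η := lt_min (mul_pos (by linarith) hμ) (by positivity)
  have hη1 : η ≤ (s₂ - s₁) * μ := min_le_left _ _
  have hη2 : η * (4 * t₀) ≤ d * m := (le_div_iff₀ (by positivity)).1 (min_le_right _ _)
  -- The gain will be at least `a * (A + B + F)`.
  set a := min (η / 2) (min (d * m * t₀ / 4) (d * m)) with ha
  have ha0 : 0 < a := lt_min (by positivity) (lt_min (by positivity) (by positivity))
  have ha1 : a ≤ η / 2 := min_le_left _ _
  have ha2 : a ≤ d * m * t₀ / 4 := (min_le_right _ _).trans (min_le_left _ _)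
  have ha3 : a ≤ d * m := (min_le_right _ _).trans (min_le_right _ _)
  -- The loss is at most `|t' - t| * K * (A + B + F)`.
  set K := s₂ * μ * (5 + 4 * t₀) + g * N + s₂ ^ 2 * L with hK
  have hK0 : 0 < K := by positivity
  refine ⟨min (t₀ / 2) (a / (2 * K)), lt_min (by positivity) (by positivity), ?_⟩
  -- The moments: `A = ∫ψ'²`, `B = ∫ψ²`, `C = ∫ψψ''`, `F = ∫ψ''²`, `P = ∫ρ'ψ²`, `R = ∫ρψ²`, `S =
  -- ∫ρψ'²`.
  intro t t' ht ht' A B C F P R S hA hB hF hq hP hR hR' hS hbase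
  obtain ⟨ht1, ht2⟩ := abs_lt.1 (ht.trans_le (min_le_left _ _))
  obtain ⟨ht1', ht2'⟩ := abs_lt.1 (ht'.trans_le (min_le_left _ _))
  set e := |t' - t| with he
  have he0 : 0 ≤ e := abs_nonneg _
  have heK : e * K ≤ a := by
    have h1 := abs_sub_le t' t₀ t
    rw [abs_sub_comm t₀ t] at h1
    have h2 := ht.trans_le (min_le_right _ _)
    have h3 := ht'.trans_le (min_le_right _ _)
    have h4 : e ≤ a / K := by
      have : a / (2 * K) + a / (2 * K) = a / K := by field_simp; ring
      linarith
    exact (le_div_iff₀ hK0).1 h4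
  have hC : |2 * C| ≤ B + F := abs_le.2 ⟨by linarith [hq 1], by linarith [hq (-1)]⟩
  have htpos : 0 < t := by linarith
  -- gain
  have hD : F / 2 - t ^ 2 * B ≤ 4 * t * A + (t ^ 2 * B + 2 * t * C + F) := by
    -- Evaluating at `2t` gives `2tC ≥ -2t²B - F/2`, which keeps half of `F`.
    have := hq (2 * t)
    have : 0 ≤ t * A := by positivity
    linarith
  have hDn : 0 ≤ 4 * t * A + (t ^ 2 * B + 2 * t * C + F) := by
    have := hq t
    have : 0 ≤ t * A := by positivity
    linarith
  have gain1 : η * (F / 2 - t ^ 2 * B) ≤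
      (s₂ - s₁) * μ * (4 * t * A + (t ^ 2 * B + 2 * t * C + F)) :=
    (mul_le_mul_of_nonneg_left hD hη0.le).trans (mul_le_mul_of_nonneg_right hη1 hDn)
  have gain2 : d * m * (t * B + A) ≤ d * (t * R + S) := by
    have h1 := mul_le_mul_of_nonneg_left hR htpos.le
    have h2 := mul_le_mul_of_nonneg_left (add_le_add h1 hS) hd0.le
    linarith
  have gain3 : η * t ^ 2 * B ≤ d * m * (t / 2) * B := by
    have h1 : η * (2 * t) ≤ d * m :=
      (mul_le_mul_of_nonneg_left (by linarith) hη0.le).trans hη2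
    have h2 : 0 ≤ t * B := by positivity
    linarith [mul_le_mul_of_nonneg_right h1 h2]
  have gain4 : a * (A + B + F) ≤ η * (F / 2) + d * m * (t / 2) * B + d * m * A := by
    have h1 := mul_le_mul_of_nonneg_right ha1 hF
    have h2 := mul_le_mul_of_nonneg_right ha3 hA
    have h3 : a ≤ d * m * (t / 2) := by
      have : d * m * (t₀ / 4) ≤ d * m * (t / 2) :=
        mul_le_mul_of_nonneg_left (by linarith) (by positivity)
      linarith
    have h4 := mul_le_mul_of_nonneg_right h3 hB
    linarith
  -- loss
  have hlow : ∀ x y : ℝ, |x| ≤ y → -(e * y) ≤ (t' - t) * x := fun x y hxy => by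
    have h1 : |(t' - t) * x| ≤ e * y := by
      rw [abs_mul]
      exact mul_le_mul_of_nonneg_left hxy he0
    exact (abs_le.1 h1).1
  have loss1 : -(e * ((5 + 4 * t₀) * (A + B + F))) ≤
      (t' - t) * (4 * A + (t' + t) * B + 2 * C) := by
    refine hlow _ _ ?_
    have h1 : (t' + t) * B ≤ (3 * t₀) * B := mul_le_mul_of_nonneg_right (by linarith) hB
    have h2 : 0 ≤ (t' + t) * B := mul_nonneg (by linarith) hB
    obtain ⟨h3, h4⟩ := abs_le.1 hC
    have h5 : 0 ≤ t₀ * A := by positivity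
    have h6 : 0 ≤ t₀ * B := by positivity
    have h7 : 0 ≤ t₀ * F := by positivity
    exact abs_le.2 ⟨by linarith, by linarith⟩
  have loss2 : -(e * (N * (A + B + F))) ≤ (t' - t) * -P := by
    refine hlow _ _ ?_
    rw [abs_neg]
    exact hP.trans (mul_le_mul_of_nonneg_left (by linarith) hN)
  have loss3 : -(e * (L * (A + B + F))) ≤ (t' - t) * R := by
    refine hlow _ _ ?_
    rw [abs_of_nonneg ((mul_nonneg hm.le hB).trans hR)]
    exact hR'.trans (mul_le_mul_of_nonneg_left (by linarith) hL)
  have loss1' := mul_le_mul_of_nonneg_left loss1 (mul_pos hs₂ hμ).le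
  have loss2' := mul_le_mul_of_nonneg_left loss2 hg.le
  have loss3' := mul_le_mul_of_nonneg_left loss3 (sq_nonneg s₂)
  have hfin : e * K * (A + B + F) ≤ a * (A + B + F) :=
    mul_le_mul_of_nonneg_right heK (by linarith)
  have hsplit : s₂ * μ * (4 * t' * A + (t' ^ 2 * B + 2 * t' * C + F)) - g * t' * P
        + s₂ ^ 2 * (t' * R + S) =
      (s₁ * μ * (4 * t * A + (t ^ 2 * B + 2 * t * C + F)) - g * t * P + s₁ ^ 2 * (t * R + S))
      + (s₂ - s₁) * μ * (4 * t * A + (t ^ 2 * B + 2 * t * C + F)) + d * (t * R + S)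
      + s₂ * μ * ((t' - t) * (4 * A + (t' + t) * B + 2 * C)) + g * ((t' - t) * -P)
      + s₂ ^ 2 * ((t' - t) * R) := by
    linear_combination (t * R + S) * hd
  have hKe : e * K * (A + B + F) = s₂ * μ * (e * ((5 + 4 * t₀) * (A + B + F)))
      + g * (e * (N * (A + B + F))) + s₂ ^ 2 * (e * (L * (A + B + F))) := by
    rw [hK]; ring
  rw [hsplit]
  linarith

section Continuity

variable {ρ : ℝ → ℝ} {m L N g μ : ℝ}

/-- In terms of growth rates: `λ(k) ≤ s₁` forces `λ(k') ≤ s₂`. As `k` and `k'` are both free near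
`k₀`, either may be taken to be `k₀`, giving lower and upper semicontinuity. -/
theorem DensityBounds.exists_neg_sq_le_alpha_perturbation (h : DensityBounds ρ m L N)
    (hRT : ∃ x₀ : ℝ, 0 < deriv ρ x₀) (hg : 0 < g) (hμ : 0 < μ) {k₀ s₁ s₂ : ℝ} (hk₀ : 0 < k₀)
    (hs₁ : 0 < s₁) (hs : s₁ < s₂) :
    ∃ δ > 0, ∀ k k' : ℝ, 0 < k → 0 < k' → |k ^ 2 - k₀ ^ 2| < δ → |k' ^ 2 - k₀ ^ 2| < δ →
      -s₁ ^ 2 ≤ alpha ρ g μ k s₁ → -s₂ ^ 2 ≤ alpha ρ g μ k' s₂ := by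
  obtain ⟨δ, hδ, H⟩ := exists_perturbation_radius h.pos
    (h.pos.le.trans ((h.le 0).trans (h.ge 0))) ((abs_nonneg _).trans (h.abs_deriv_le 0))
    hg hμ (pow_pos hk₀ 2) hs₁ hs
  refine ⟨δ, hδ, fun k k' hk hk' hkδ hkδ' h1 => ?_⟩
  rw [h.le_alpha_iff hRT hg hμ hk hs₁.le] at h1
  rw [h.le_alpha_iff hRT hg hμ hk' (hs₁.trans hs).le]
  intro ψ
  have h2 := h1 ψ
  rw [h.energy_eq, h.constraint_eq, dissipation, integral_add_sq] at h2 ⊢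
  have := H _ _ hkδ hkδ' (∫ x, ψ.d1 x ^ 2) (∫ x, ψ.toFun x ^ 2)
    (∫ x, ψ.toFun x * ψ.d2 x) (∫ x, ψ.d2 x ^ 2) (weightedSq (deriv ρ) ψ.toFun)
    (weightedSq ρ ψ.toFun) (weightedSq ρ ψ.d1)
    (integral_nonneg fun _ => sq_nonneg _) (integral_nonneg fun _ => sq_nonneg _)
    (integral_nonneg fun _ => sq_nonneg _)
    (fun x => by rw [← integral_add_sq]; exact integral_nonneg fun _ => sq_nonneg _)
    (h.abs_weightedSq_deriv_le ψ.memLp_toFun) (h.mul_le_weightedSq ψ.memLp_toFun)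
    (h.weightedSq_le ψ.memLp_toFun) (h.mul_le_weightedSq ψ.memLp_d1) (by linarith)
  linarith

/-- Any function solving `λ(k)² = -α(k, λ(k))` is continuous. -/
theorem DensityBounds.continuous_of_sq_eq_neg_alpha (h : DensityBounds ρ m L N)
    (hRT : ∃ x₀ : ℝ, 0 < deriv ρ x₀) (hg : 0 < g) (hμ : 0 < μ) {lam : Ioi (0 : ℝ) → ℝ}
    (hpos : ∀ k, 0 < lam k) (hlam : ∀ k : Ioi (0 : ℝ), lam k ^ 2 = -alpha ρ g μ k (lam k)) :
    Continuous lam := by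
  have key : ∀ (k : Ioi (0 : ℝ)) {s : ℝ}, 0 ≤ s → (lam k ≤ s ↔ -s ^ 2 ≤ alpha ρ g μ k s) :=
    fun k s hs => h.le_iff_neg_sq_le_alpha hRT hg hμ k.2 (hpos k) (hlam k) hs
  rw [continuous_iff_continuousAt]
  intro k₀
  have hsq : Filter.Tendsto (fun k : Ioi (0 : ℝ) => (k : ℝ) ^ 2) (nhds k₀)
      (nhds ((k₀ : ℝ) ^ 2)) := (continuous_subtype_val.pow 2).tendsto k₀
  have hnear : ∀ δ > 0, ∀ᶠ k : Ioi (0 : ℝ) in nhds k₀, |(k : ℝ) ^ 2 - (k₀ : ℝ) ^ 2| < δ :=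
    fun δ hδ => (Metric.tendsto_nhds.1 hsq) δ hδ
  refine tendsto_order.2 ⟨fun b hb => ?_, fun b hb => ?_⟩
  -- The maximum with `0` keeps `s₁` positive, since `b` may be negative.
  · obtain ⟨s₁, hs₁, hs₁'⟩ := exists_between (max_lt hb (hpos k₀))
    obtain ⟨s₂, hs₂, hs₂'⟩ := exists_between hs₁'
    have h0 : 0 < s₁ := (le_max_right _ _).trans_lt hs₁
    obtain ⟨δ, hδ, H⟩ := h.exists_neg_sq_le_alpha_perturbation hRT hg hμ k₀.2 h0 hs₂
    filter_upwards [hnear δ hδ] with k hk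
    by_contra! hle
    have h1 := (key k h0.le).1 (hle.trans ((le_max_left _ _).trans hs₁.le))
    have h2 := H k k₀ k.2 k₀.2 hk (by simpa using hδ) h1
    exact absurd ((key k₀ (h0.trans hs₂).le).2 h2) (not_le.2 hs₂')
  · obtain ⟨s₂, hs₂, hs₂'⟩ := exists_between hb
    obtain ⟨δ, hδ, H⟩ := h.exists_neg_sq_le_alpha_perturbation hRT hg hμ k₀.2 (hpos k₀) hs₂
    filter_upwards [hnear δ hδ] with k hk
    have h2 := H k₀ k k₀.2 k.2 (by simpa using hδ) hk ((key k₀ (hpos k₀).le).1 le_rfl)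
    exact ((key k ((hpos k₀).trans hs₂).le).2 h2).trans_lt hs₂'

end Continuity

/-! ### The sharp constant in `ρ' ≤ cρ`. -/

section SupremumBound

variable {ρ : ℝ → ℝ} {m L N : ℝ}

theorem DensityBounds.memLp_top_sqrt (h : DensityBounds ρ m L N) :
    MemLp (fun x => Real.sqrt (deriv ρ x / ρ x)) ∞ volume := by
  have hρ : ∀ x, 0 < ρ x := fun x => h.pos.trans_le (h.le x)
  refine memLp_top_of_bound (Real.continuous_sqrt.comp (h.continuous_deriv.div h.continuous
    fun x => (hρ x).ne')).aestronglyMeasurable (Real.sqrt (N / m))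
    (Filter.Eventually.of_forall fun x => ?_)
  rw [Real.norm_of_nonneg (Real.sqrt_nonneg _)]
  exact Real.sqrt_le_sqrt ((div_le_iff₀ (hρ x)).2 (h.deriv_le x))

/-- Where `ρ' < 0` the truncated root is `0` and the inequality is trivial; elsewhere square the
essential bound. -/
theorem DensityBounds.deriv_le_eLpNorm_sq_mul (h : DensityBounds ρ m L N) :
    ∀ᵐ x, deriv ρ x ≤
      (eLpNorm (fun x => Real.sqrt (deriv ρ x / ρ x)) ∞ volume).toReal ^ 2 * ρ x := by
  have hfin := h.memLp_top_sqrt.eLpNorm_ne_top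
  have hae := ae_le_eLpNormEssSup (f := fun x => Real.sqrt (deriv ρ x / ρ x)) (μ := volume)
  rw [← eLpNorm_exponent_top] at hae
  filter_upwards [hae] with x hx
  have h1 := ENNReal.toReal_mono hfin hx
  rw [toReal_enorm, Real.norm_of_nonneg (Real.sqrt_nonneg _)] at h1
  exact (div_le_iff₀ (h.pos.trans_le (h.le x))).1 ((Real.sqrt_le_left ENNReal.toReal_nonneg).1 h1)

end SupremumBound

end RayleighTaylor

/-- The growth rate `λ : (0, ∞) → (0, ∞)` is well defined (for each frequency `k` it is the one and
only growth rate), it is continuous, and its supremum is at most `√g ‖√(ρ'/ρ)‖_{L^∞}`. Here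
`Real.sqrt` is `0` where `ρ' < 0`, so that the norm on the right is the supremum of `√(ρ'/ρ)` over
the points where `ρ' ≥ 0`. -/
theorem proposition2p5 (ρ : ℝ → ℝ) (g μ : ℝ) (hg : 0 < g) (hμ : 0 < μ)
    (hρ_smooth : ContDiff ℝ ∞ ρ) (hρ_supp : HasCompactSupport (deriv ρ))
    (hρ_pos : 0 < ⨅ x, ρ x) (hρ_RT : ∃ x₀ : ℝ, 0 < deriv ρ x₀) :
    ∃ lam : Ioi (0 : ℝ) → Ioi (0 : ℝ),
      (∀ (k : Ioi (0 : ℝ)) (s : ℝ),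
        RayleighTaylor.IsGrowthRate ρ g μ (k : ℝ) s ↔ s = (lam k : ℝ)) ∧
      Continuous lam ∧
      MemLp (fun x => Real.sqrt (deriv ρ x / ρ x)) ∞ volume ∧
      BddAbove (range fun k => (lam k : ℝ)) ∧
      (⨆ k, (lam k : ℝ)) ≤
        Real.sqrt g * (eLpNorm (fun x => Real.sqrt (deriv ρ x / ρ x)) ∞ volume).toReal := by
  obtain ⟨m, L, N, h⟩ := RayleighTaylor.exists_densityBounds hρ_smooth hρ_supp hρ_pos
  choose lam hpos hlam using fun k : Ioi (0 : ℝ) =>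
    h.exists_sq_eq_neg_alpha hρ_RT hg hμ (k := (k : ℝ)) k.2
  have hbound : ∀ k, lam k ≤ Real.sqrt g *
      (eLpNorm (fun x => Real.sqrt (deriv ρ x / ρ x)) ∞ volume).toReal := by
    intro k
    -- With `c` the squared norm, `λ² = -α ≤ gc`.
    have h1 := h.neg_mul_le_alpha hρ_RT hg hμ k.2 (hpos k).le (sq_nonneg _)
      h.deriv_le_eLpNorm_sq_mul
    refine abs_le_of_sq_le_sq' ?_ (by positivity) |>.2
    rw [mul_pow, Real.sq_sqrt hg.le]
    linarith [hlam k]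
  refine ⟨fun k => ⟨lam k, hpos k⟩, fun k s => ?_,
    (h.continuous_of_sq_eq_neg_alpha hρ_RT hg hμ hpos hlam).subtype_mk _, h.memLp_top_sqrt,
    ⟨_, forall_mem_range.2 hbound⟩, ?_⟩
  · rw [h.isGrowthRate_iff hρ_RT hg hμ k.2]
    constructor
    · rintro ⟨hs, hsq⟩
      exact le_antisymm
        ((h.le_iff_neg_sq_le_alpha hρ_RT hg hμ k.2 hs hsq (hpos k).le).2 (by linarith [hlam k]))
        ((h.le_iff_neg_sq_le_alpha hρ_RT hg hμ k.2 (hpos k) (hlam k) hs.le).2 (by linarith))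
    · rintro rfl
      exact ⟨hpos k, hlam k⟩
  · have : Nonempty (Ioi (0 : ℝ)) := ⟨⟨1, mem_Ioi.2 one_pos⟩⟩
    exact ciSup_le hbound
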